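/- **Theorem 1.** Let $V$ be a finite set (the vertex set of a graph or hypergraph) and let $K$ be a set of colours. A *setting* is a pair $(Z,c)$ with $Z\subseteq V$ and $c:Z\to K$. Let a set of *bad settings* $(Z,c)$ be given, all with $Z\neq\emptyset$. A colouring $f:V\to K$ *avoids* them if $f|_Z\neq c$ for every bad setting $(Z,c)$. Let: 1. $\mathcal Z:=\{Z\subseteq V:\text{ there is } c \text{ such that } (Z,c) \text{ is a bad setting}\}=\{Z_i: i\in I\}$, indexed bijectively by a finite set $I\subset\mathbb N$. 2. For each $i\in I$: (a) $C_i:=\{c: (Z_i,c)\text{ is a bad setting}\}$; (b) $k_i,m_i\in\mathbb N$ be such that for every $v\in Z_i$ there is a set of $k_i$ vertices of $Z_i$, all different from $v$, such that every colouring of these $k_i$ vertices has at most $m_i$ extensions to a colouring $c\in C_i$; (c) $l_i:=|Z_i|-k_i$. 3. $E:=\{l_i: i\in I\}$. 4. For $l\in E$ and $v\in V$, $Q_l(v)$ be the set of those subsets of $V$ that contain $v$ and are equal to some $Z_j\in\mathcal Z$ with $l_j=l$, and $d_l:=\max_{v\in V}|Q_l(v)|$. 5. $\phi_E(x):=1+\sum_{l\in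 E}x^l$, $\tau>0$ be a real number with $\phi_E(\tau)-\tau\phi_E'(\tau)=0$, and $\gamma:=\phi_E'(\tau)$. Put $N:=\big\lceil \gamma\,\sup_{i\in I}(d_{l_i}m_i)^{1/l_i}\big\rceil$. Then there exists a colouring of $V$ with $N$ colours that avoids all bad settings: for every set $S\subseteq K$ of $N$ colours there is $f:V\to S$ that avoids all bad settings. In particular, this applies to the variable version of the Lovász Local Lemma: let $(\psi_v)_{v\in V}$ be independent $K$-valued random variables and let $(A_x)_{x\in X}$ be a finite family of events, where $A_x$ depends only on the variables $\psi_v$ with $v\in\mathrm{vbl}(A_x)\subseteq V$ and occurs exactly when their configuration lies in a set $c(A_x)$. If the bad settings above are the pairs $(\mathrm{vbl}(A_x),c)$ with $x\in X$ and $c\in c(A_x)$, and if each $\psi_v$ takes at least $N$ different values with positive probability, then with positive probability none of the events $A_x$ occurs. -/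

import Mathlib

open MeasureTheory ProbabilityTheory

namespace EntropyCompression

/-- A setting: a set `Z` of vertices together with a colouring of `Z` by colours from `K`. -/
abbrev Setting (V K : Type*) := (Z : Finset V) × ({v // v ∈ Z} → K)

/-- The sets `Z` for which there is a colouring `c` of `Z` such that `(Z, c)` is a bad setting. -/
def badSets {V K : Type*} (bad : Set (Setting V K)) : Set (Finset V) :=
  {Z | ∃ c : {v // v ∈ Z} → K, (⟨Z, c⟩ : Setting V K) ∈ bad}

/-- The bad colourings of the set `Z`. -/
def badColorings {V K : Type*} (bad : Set (Setting V K)) (Z : Finset V) :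
    Set ({v // v ∈ Z} → K) :=
  {c | (⟨Z, c⟩ : Setting V K) ∈ bad}

/-- A colouring of all vertices avoids the bad settings if its restriction to `Z` is different
from `c`, for every bad setting `(Z, c)`. -/
def Avoids {V K : Type*} (bad : Set (Setting V K)) (f : V → K) : Prop :=
  ∀ s ∈ bad, (fun v : {v // v ∈ s.1} => f v) ≠ s.2

/-- For each vertex `v` of `Z` there are `k` vertices of `Z`, different from `v`, such that every
colouring `p` of these vertices has at most `m` extensions to a bad colouring of `Z`. -/
def ExtensionBound {V K : Type*} (bad : Set (Setting V K)) (Z : Finset V) (k m : ℕ) : Prop :=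
  ∀ v ∈ Z, ∃ F : Finset V, F ⊆ Z ∧ v ∉ F ∧ F.card = k ∧
    ∀ p : {u // u ∈ F} → K,
      {c ∈ badColorings bad Z |
        ∀ (u : V) (hu : u ∈ F) (hz : u ∈ Z), c ⟨u, hz⟩ = p ⟨u, hu⟩}.encard ≤ (m : ℕ∞)

/-- `l_i = |Z_i| - k_i`. -/
def lVal {V : Type*} (Z : ℕ → Finset V) (k : ℕ → ℕ) (i : ℕ) : ℕ := (Z i).card - k i

/-- The set `E` of all values `l_i`. -/
def lSet {V : Type*} (I : Finset ℕ) (Z : ℕ → Finset V) (k : ℕ → ℕ) : Finset ℕ :=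
  I.image (lVal Z k)

/-- `Q_l(v)`: the sets of vertices that contain `v` and are equal to some `Z_j` with `l_j = l`. -/
def Q {V : Type*} (I : Finset ℕ) (Z : ℕ → Finset V) (k : ℕ → ℕ) (l : ℕ) (v : V) :
    Set (Finset V) :=
  {Y | v ∈ Y ∧ ∃ j ∈ I, Z j = Y ∧ lVal Z k j = l}

/-- `d_l`, the maximum over the vertices `v` of the number of elements of `Q_l(v)`. -/
noncomputable def d {V : Type*} [Fintype V] (I : Finset ℕ) (Z : ℕ → Finset V) (k : ℕ → ℕ)
    (l : ℕ) : ℕ :=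
  Finset.univ.sup fun v : V => (Q I Z k l v).ncard

/-- `φ_E(x) = 1 + ∑_{l ∈ E} x ^ l`. -/
noncomputable def phi (E : Finset ℕ) (x : ℝ) : ℝ := 1 + ∑ l ∈ E, x ^ l

/-- The number of colours `⌈φ_E'(τ) · sup_{i ∈ I} (d_{l_i} m_i)^{1 / l_i}⌉`. -/
noncomputable def numColors {V : Type*} [Fintype V] (I : Finset ℕ) (Z : ℕ → Finset V)
    (k m : ℕ → ℕ) (τ : ℝ) : ℕ :=
  ⌈deriv (phi (lSet I Z k)) τ *
    ⨆ i : {i // i ∈ I}, ((d I Z k (lVal Z k i) : ℝ) * (m i : ℝ)) ^ (1 / (lVal Z k i : ℝ))⌉₊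

/-- The bad settings of a family of events: the event with index `x` depends on the variables in
`vbl x` and occurs exactly in the configurations in `c x` of these variables. -/
def eventSettings {V K X : Type*} (vbl : X → Finset V) (c : ∀ x, Set ({v // v ∈ vbl x} → K)) :
    Set (Setting V K) :=
  {s | ∃ x, ∃ b ∈ c x, s = ⟨vbl x, b⟩}

end EntropyCompression

namespace EntropyCompression

/-! The argument counts colourings. Let `a(W)` be the number of list colourings of all of `V` that
avoid the bad settings supported in `W`; vertices outside `W` stay free. The claim is `ρ * a(W \
{v}) ≤ a(W)` for `v ∈ W`, which gives `a(V) ≥ ρ ^ |V| * a(∅) > 0`. Adding `v` loses only colourings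
that are bad on some `Z_i` containing `v`. Forgetting the colours on `Z_i \ F`, which has `l_i`
elements including `v`, and double counting bounds this loss by `a(W \ Z_i ∪ F ∩ W) * m_i / N ^ l_i`
up to the vertex `v` itself; induction turns it into `m_i * ρ / (N * ρ) ^ l_i` times `a(W \ {v})`.
So the claim holds once `ρ + ∑ m_i * ρ / (N * ρ) ^ l_i ≤ 1` over the `Z_i` containing each `v`. The
choice `N * ρ = T / τ`, with `T` the supremum in `N`, bounds this sum by `ρ * φ_E(τ) = γ * T / N ≤
1`. -/

open Finset in
/-- The list colourings of all vertices that avoid the bad settings supported in `W`. -/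
noncomputable def partialAvoiders {V K : Type*} [Fintype V] [DecidableEq V]
    (bad : Set (Setting V K)) (L : V → Finset K) (W : Finset V) : Finset (V → K) := by
  classical
  exact {f ∈ Fintype.piFinset L |
    ∀ s ∈ bad, s.1 ⊆ W → (fun v : {v // v ∈ s.1} => f v) ≠ s.2}

open Finset in
/-- The members of `partialAvoiders` whose restriction to `Y` is a bad colouring of `Y`. -/
noncomputable def partialAvoidersBadOn {V K : Type*} [Fintype V] [DecidableEq V]
    (bad : Set (Setting V K)) (L : V → Finset K) (W Y : Finset V) : Finset (V → K) := by
  classical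
  exact {f ∈ partialAvoiders bad L W |
    (fun v : {v // v ∈ Y} => f v) ∈ badColorings bad Y}

/-! ### Recolouring and the inductive count -/

section Counting

variable {V K : Type*} [Fintype V] [DecidableEq V] {bad : Set (Setting V K)}
  {L : V → Finset K}

theorem mem_partialAvoiders {W : Finset V} {f : V → K} :
    f ∈ partialAvoiders bad L W ↔ (∀ v, f v ∈ L v) ∧
      ∀ s ∈ bad, s.1 ⊆ W → (fun v : {v // v ∈ s.1} => f v) ≠ s.2 := by
  simp [partialAvoiders]

theorem mem_partialAvoidersBadOn {W Y : Finset V} {f : V → K} :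
    f ∈ partialAvoidersBadOn bad L W Y ↔ f ∈ partialAvoiders bad L W ∧
      (fun v : {v // v ∈ Y} => f v) ∈ badColorings bad Y := by
  simp [partialAvoidersBadOn]

/-- Recolouring `Y \ F` gives a double count of the colourings that are bad on `Y`. -/
theorem card_partialAvoidersBadOn_mul_le {N : ℕ} (hL : ∀ v, (L v).card = N)
    (W Y F : Finset V) (m : ℕ)
    (hm : ∀ p : {u // u ∈ F} → K,
      {c ∈ badColorings bad Y |
        ∀ (u : V) (hu : u ∈ F) (hz : u ∈ Y), c ⟨u, hz⟩ = p ⟨u, hu⟩}.encard ≤ (m : ℕ∞)) :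
    (partialAvoidersBadOn bad L W Y).card * N ^ (Y \ F).card ≤
      (partialAvoiders bad L (W \ (Y \ F))).card * m := by
  classical
  -- Each bad `f` has at least `N ^ |Y \ F|` recolourings `g`, all still avoiding because no
  -- remaining bad setting meets `Y \ F`. Each `g` arises from at most `m` of the `f`: `g` fixes `f`
  -- off `Y \ F`, hence on `F`, so only extensions from `F` to `Y` matter.
  refine Finset.card_mul_le_card_mul (fun f g : V → K => ∀ u, u ∉ Y \ F → g u = f u) ?_ ?_
  · intro f hf
    rw [mem_partialAvoidersBadOn, mem_partialAvoiders] at hf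
    obtain ⟨⟨hfL, hfW⟩, -⟩ := hf
    have hcard : (Fintype.piFinset fun u => if u ∈ Y \ F then L u else {f u}).card
        = N ^ (Y \ F).card := by
      rw [Fintype.card_piFinset]
      have : ∀ u, (if u ∈ Y \ F then L u else {f u}).card = if u ∈ Y \ F then N else 1 := by
        intro u
        split_ifs
        · exact hL u
        · simp
      rw [Finset.prod_congr rfl fun u _ => this u, Finset.prod_ite_mem]
      simp
    rw [← hcard]
    refine Finset.card_le_card fun g hg => ?_
    rw [Fintype.mem_piFinset] at hg
    have hgf : ∀ u, u ∉ Y \ F → g u = f u := fun u hu => by simpa [hu] using hg u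
    rw [Finset.mem_bipartiteAbove, mem_partialAvoiders]
    refine ⟨⟨fun v => ?_, fun s hs hsW h => ?_⟩, hgf⟩
    · by_cases hv : v ∈ Y \ F
      · have := hg v
        rwa [if_pos hv] at this
      · rw [hgf v hv]
        exact hfL v
    · refine hfW s hs (hsW.trans Finset.sdiff_subset) ?_
      rw [← h]
      funext v
      exact (hgf v (Finset.mem_sdiff.1 (hsW v.2)).2).symm
  · intro g _
    have hinj : Set.InjOn (fun (f : V → K) (v : {v // v ∈ Y}) => f v)
        (Finset.bipartiteBelow (fun f g : V → K => ∀ u, u ∉ Y \ F → g u = f u)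
          (partialAvoidersBadOn bad L W Y) g : Set (V → K)) := by
      intro f hf f' hf' h
      rw [Finset.mem_coe, Finset.mem_bipartiteBelow] at hf hf'
      funext u
      by_cases hu : u ∈ Y
      · exact congrFun h ⟨u, hu⟩
      · have hu' : u ∉ Y \ F := fun h => hu (Finset.mem_sdiff.1 h).1
        rw [← hf.2 u hu', ← hf'.2 u hu']
    have hsub : (fun (f : V → K) (v : {v // v ∈ Y}) => f v) ''
        (Finset.bipartiteBelow (fun f g : V → K => ∀ u, u ∉ Y \ F → g u = f u)
          (partialAvoidersBadOn bad L W Y) g : Set (V → K)) ⊆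
        {c ∈ badColorings bad Y |
          ∀ (u : V) (_ : u ∈ F) (hz : u ∈ Y), c ⟨u, hz⟩ = g u} := by
      rintro _ ⟨f, hf, rfl⟩
      rw [Finset.mem_coe, Finset.mem_bipartiteBelow, mem_partialAvoidersBadOn] at hf
      refine ⟨hf.1.2, fun u hu _ => (hf.2 u fun h => (Finset.mem_sdiff.1 h).2 hu).symm⟩
    have := (Set.encard_le_encard hsub).trans (hm fun u => g u)
    rw [hinj.encard_image, Set.encard_coe_eq_coe_finsetCard] at this
    exact_mod_cast this

theorem partialAvoiders_erase_subset [DecidableEq (V → K)] {I : Finset ℕ} {Z : ℕ → Finset V}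
    (hZ : badSets bad ⊆ Z '' I) (W : Finset V) (v : V) :
    partialAvoiders bad L (W.erase v) ⊆ partialAvoiders bad L W ∪
      (I.filter fun i => v ∈ Z i).biUnion
        fun i => partialAvoidersBadOn bad L (W.erase v) (Z i) := by
  intro f hf
  by_cases hW : f ∈ partialAvoiders bad L W
  · exact Finset.mem_union_left _ hW
  refine Finset.mem_union_right _ ?_
  have hf' := mem_partialAvoiders.1 hf
  rw [mem_partialAvoiders] at hW
  push Not at hW
  obtain ⟨⟨Y, c⟩, hs, hsW, h⟩ := hW hf'.1
  have hv : v ∈ Y := by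
    by_contra hv
    exact hf'.2 ⟨Y, c⟩ hs (Finset.subset_erase.2 ⟨hsW, hv⟩) h
  obtain ⟨i, hi, rfl⟩ := hZ ⟨c, hs⟩
  refine Finset.mem_biUnion.2 ⟨i, Finset.mem_filter.2 ⟨hi, hv⟩, ?_⟩
  refine mem_partialAvoidersBadOn.2 ⟨hf, ?_⟩
  dsimp only at h
  rw [h]
  exact hs

/-- If every vertex satisfies a local weight condition, enlarging the set on which bad settings
are avoided by one vertex loses at most a factor `ρ`. -/
theorem pow_mul_card_partialAvoiders_le {I : Finset ℕ} {Z : ℕ → Finset V} {k m : ℕ → ℕ}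
    (hZ : badSets bad ⊆ Z '' I)
    (hkm : ∀ i ∈ I, ExtensionBound bad (Z i) (k i) (m i))
    {N : ℕ} (hL : ∀ v, (L v).card = N) (hN : 0 < N) {ρ : ℝ} (hρ : 0 < ρ)
    (hw : ∀ v, ρ + ∑ i ∈ I with v ∈ Z i, (m i : ℝ) * ρ / (N * ρ) ^ lVal Z k i ≤ 1)
    (W : Finset V) : ∀ U ⊆ W, ρ ^ (W \ U).card * ((partialAvoiders bad L U).card : ℝ) ≤
      (partialAvoiders bad L W).card := by
  classical
  induction W using Finset.strongInduction with
  | H W ih =>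
  intro U hU
  -- General `U` is needed because recolouring frees many vertices at once.
  rcases hU.eq_or_ssubset with rfl | hUW
  · simp
  obtain ⟨v, hvW, hvU⟩ := Finset.exists_of_ssubset hUW
  have hss : W.erase v ⊂ W := Finset.erase_ssubset hvW
  have hρ1 : ρ ≤ 1 := le_trans (le_add_of_nonneg_right
    (Finset.sum_nonneg fun i _ => by positivity)) (hw v)
  have hN' : (0 : ℝ) < N := Nat.cast_pos.2 hN
  set a : ℝ := ((partialAvoiders bad L (W.erase v)).card : ℝ) with ha
  have hb : ∀ i ∈ I.filter fun i => v ∈ Z i,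
      ((partialAvoidersBadOn bad L (W.erase v) (Z i)).card : ℝ) ≤
        (m i : ℝ) * ρ / (N * ρ) ^ lVal Z k i * a := by
    intro i hi
    rw [Finset.mem_filter] at hi
    obtain ⟨F, hFZ, hvF, hFk, hF⟩ := hkm i hi.1 v hi.2
    have hD : (Z i \ F).card = lVal Z k i := by
      rw [Finset.card_sdiff_of_subset hFZ, hFk, lVal]
    have hvD : v ∈ Z i \ F := Finset.mem_sdiff.2 ⟨hi.2, hvF⟩
    have hcount := card_partialAvoidersBadOn_mul_le hL (W.erase v) (Z i) F (m i) hF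
    have hih := ih (W.erase v) hss (W.erase v \ (Z i \ F)) Finset.sdiff_subset
    -- The vertex `v` lies in `Z i \ F` but is already gone from `W.erase v`, so at most `l_i - 1`
    -- vertices are removed. This saves the extra factor `ρ` in the weight.
    have hle : (W.erase v \ (W.erase v \ (Z i \ F))).card + 1 ≤ lVal Z k i := by
      rw [← hD, ← Finset.card_erase_add_one hvD]
      refine Nat.add_le_add_right (Finset.card_le_card fun u hu => ?_) 1
      simp only [Finset.mem_sdiff, Finset.mem_erase] at hu ⊢
      tauto
    have hpow : ρ ^ lVal Z k i ≤ ρ * ρ ^ (W.erase v \ (W.erase v \ (Z i \ F))).card := by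
      rw [← pow_succ']
      exact pow_le_pow_of_le_one hρ.le hρ1 hle
    rw [hD] at hcount
    have hcount' : ((partialAvoidersBadOn bad L (W.erase v) (Z i)).card : ℝ) *
        (N : ℝ) ^ lVal Z k i ≤
        ((partialAvoiders bad L (W.erase v \ (Z i \ F))).card : ℝ) * m i := by
      exact_mod_cast hcount
    rw [div_mul_eq_mul_div, le_div_iff₀ (by positivity), mul_pow, ← mul_assoc]
    calc _ ≤ ((partialAvoiders bad L (W.erase v \ (Z i \ F))).card : ℝ) * m i *
          ρ ^ lVal Z k i := by gcongr
      _ ≤ ((partialAvoiders bad L (W.erase v \ (Z i \ F))).card : ℝ) * m i *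
          (ρ * ρ ^ (W.erase v \ (W.erase v \ (Z i \ F))).card) := by gcongr
      _ = m i * ρ * (ρ ^ (W.erase v \ (W.erase v \ (Z i \ F))).card *
          ((partialAvoiders bad L (W.erase v \ (Z i \ F))).card : ℝ)) := by ring
      _ ≤ m i * ρ * a := by gcongr
  have hstep : ρ * a ≤ ((partialAvoiders bad L W).card : ℝ) := by
    have h1 := (Finset.card_le_card
      (partialAvoiders_erase_subset (L := L) hZ W v)).trans (Finset.card_union_le _ _)
    have h2 := h1.trans (Nat.add_le_add_left Finset.card_biUnion_le _)
    have h3 : a ≤ ((partialAvoiders bad L W).card : ℝ) + ∑ i ∈ I with v ∈ Z i,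
        ((partialAvoidersBadOn bad L (W.erase v) (Z i)).card : ℝ) := by
      rw [ha]
      exact_mod_cast h2
    have h4 := Finset.sum_le_sum hb
    rw [← Finset.sum_mul] at h4
    have h5 := mul_le_mul_of_nonneg_right (hw v) (Nat.cast_nonneg (α := ℝ)
      (partialAvoiders bad L (W.erase v)).card)
    rw [← ha, add_mul] at h5
    linarith
  have hcardWU : (W \ U).card = (W.erase v \ U).card + 1 := by
    rw [← Finset.card_erase_add_one (Finset.mem_sdiff.2 ⟨hvW, hvU⟩), Finset.erase_sdiff_comm]
  have hih := ih (W.erase v) hss U (Finset.subset_erase.2 ⟨hU, hvU⟩)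
  rw [hcardWU, pow_succ', mul_assoc]
  exact (mul_le_mul_of_nonneg_left hih hρ.le).trans hstep

/-- Nonempty bad sets leave nothing to avoid at `W = ∅`, so the count starts from a positive number.
-/
theorem exists_avoids_of_weight_le {I : Finset ℕ} {Z : ℕ → Finset V} {k m : ℕ → ℕ}
    (hne : ∀ s ∈ bad, s.1.Nonempty) (hZ : badSets bad ⊆ Z '' I)
    (hkm : ∀ i ∈ I, ExtensionBound bad (Z i) (k i) (m i))
    {N : ℕ} (hL : ∀ v, (L v).card = N) (hN : 0 < N) {ρ : ℝ} (hρ : 0 < ρ)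
    (hw : ∀ v, ρ + ∑ i ∈ I with v ∈ Z i, (m i : ℝ) * ρ / (N * ρ) ^ lVal Z k i ≤ 1) :
    ∃ f : V → K, (∀ v, f v ∈ L v) ∧ Avoids bad f := by
  have h := pow_mul_card_partialAvoiders_le hZ hkm hL hN hρ hw Finset.univ ∅
    (Finset.empty_subset _)
  have h0 : 0 < (partialAvoiders bad L ∅).card := by
    have hLne : ∀ v, (L v).Nonempty := fun v => Finset.card_pos.1 (by rw [hL v]; exact hN)
    choose g hg using hLne
    refine Finset.card_pos.2 ⟨g, mem_partialAvoiders.2 ⟨hg, fun s hs hs0 => ?_⟩⟩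
    exact absurd (Finset.subset_empty.1 hs0) (hne s hs).ne_empty
  have hpos : (0 : ℝ) < (partialAvoiders bad L Finset.univ).card :=
    lt_of_lt_of_le (mul_pos (pow_pos hρ _) (Nat.cast_pos.2 h0)) h
  obtain ⟨f, hf⟩ := Finset.card_pos.1 (Nat.cast_pos.1 hpos)
  rw [mem_partialAvoiders] at hf
  exact ⟨f, hf.1, fun s hs => hf.2 s hs (Finset.subset_univ _)⟩

end Counting

/-! ### The weight condition from `τ` and `N` -/

section Parameters

variable {V K : Type*} {bad : Set (Setting V K)}

theorem lVal_pos {I : Finset ℕ} {Z : ℕ → Finset V} {k m : ℕ → ℕ}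
    (hkm : ∀ i ∈ I, ExtensionBound bad (Z i) (k i) (m i)) {i : ℕ} (hi : i ∈ I)
    (hne : (Z i).Nonempty) : 0 < lVal Z k i := by
  obtain ⟨v, hv⟩ := hne
  obtain ⟨F, hFZ, hvF, hFk, -⟩ := hkm i hi v hv
  have := Finset.card_lt_card (Finset.ssubset_iff_subset_ne.2
    ⟨hFZ, fun h => hvF (h ▸ hv)⟩)
  unfold lVal
  omega

/-- A bad colouring extends its own restriction to `F`. -/
theorem ExtensionBound.pos {Y : Finset V} {k m : ℕ} (h : ExtensionBound bad Y k m)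
    (hne : Y.Nonempty) (hY : Y ∈ badSets bad) : 0 < m := by
  obtain ⟨v, hv⟩ := hne
  obtain ⟨c, hc⟩ := hY
  obtain ⟨F, hFZ, -, -, hF⟩ := h v hv
  have hcard := hF fun u => c ⟨u, hFZ u.2⟩
  rw [Nat.pos_iff_ne_zero]
  rintro rfl
  rw [Nat.cast_zero, nonpos_iff_eq_zero, Set.encard_eq_zero] at hcard
  exact (Set.eq_empty_iff_forall_notMem.1 hcard c) ⟨hc, fun _ _ _ => rfl⟩

variable [Fintype V]

theorem ncard_Q_le_d (I : Finset ℕ) (Z : ℕ → Finset V) (k : ℕ → ℕ) (l : ℕ) (v : V) :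
    (Q I Z k l v).ncard ≤ d I Z k l :=
  Finset.le_sup (f := fun v : V => (Q I Z k l v).ncard) (Finset.mem_univ v)

theorem card_filter_le_d [DecidableEq V] {I : Finset ℕ} {Z : ℕ → Finset V}
    (hZ : Set.InjOn Z I) (k : ℕ → ℕ) (l : ℕ) (v : V) :
    (I.filter fun i => v ∈ Z i ∧ lVal Z k i = l).card ≤ d I Z k l := by
  refine le_trans ?_ (ncard_Q_le_d I Z k l v)
  rw [← Set.ncard_coe_finset, ← Set.InjOn.ncard_image (f := Z)]
  · refine Set.ncard_le_ncard ?_ (Set.toFinite _)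
    rintro _ ⟨i, hi, rfl⟩
    rw [Finset.mem_coe, Finset.mem_filter] at hi
    exact ⟨hi.2.1, i, hi.1, rfl, hi.2.2⟩
  · exact hZ.mono fun i hi => (Finset.mem_filter.1 hi).1

theorem d_pos {I : Finset ℕ} {Z : ℕ → Finset V} (k : ℕ → ℕ) {i : ℕ} (hi : i ∈ I)
    (hne : (Z i).Nonempty) : 0 < d I Z k (lVal Z k i) := by
  obtain ⟨v, hv⟩ := hne
  refine lt_of_lt_of_le ?_ (ncard_Q_le_d I Z k _ v)
  exact (Set.ncard_pos (Set.toFinite _)).2 ⟨Z i, hv, i, hi, rfl, rfl⟩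

/-- The colours come from lists, one for each vertex, of the size in the theorem. -/
theorem exists_avoids_of_card_eq_numColors [DecidableEq V]
    (hne : ∀ s ∈ bad, s.1.Nonempty) (I : Finset ℕ) (Z : ℕ → Finset V)
    (hZ : Set.BijOn Z (I : Set ℕ) (badSets bad)) (k m : ℕ → ℕ)
    (hkm : ∀ i ∈ I, ExtensionBound bad (Z i) (k i) (m i))
    (τ : ℝ) (hτ : 0 < τ)
    (hτE : phi (lSet I Z k) τ - τ * deriv (phi (lSet I Z k)) τ = 0)
    (L : V → Finset K) (hL : ∀ v, (L v).card = numColors I Z k m τ) :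
    ∃ f : V → K, (∀ v, f v ∈ L v) ∧ Avoids bad f := by
  have hZne : ∀ i ∈ I, (Z i).Nonempty := fun i hi => by
    obtain ⟨c, hc⟩ := hZ.mapsTo hi
    exact hne _ hc
  have hl : ∀ i ∈ I, 0 < lVal Z k i := fun i hi => lVal_pos hkm hi (hZne i hi)
  have hm : ∀ i ∈ I, 0 < m i := fun i hi => (hkm i hi).pos (hZne i hi) (hZ.mapsTo hi)
  have hd : ∀ i ∈ I, 0 < d I Z k (lVal Z k i) := fun i hi => d_pos k hi (hZne i hi)
  -- For empty `I`, `φ_E` is constantly 1 and the equation for `τ` would read `1 = 0`.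
  have hI : I.Nonempty := by
    rw [Finset.nonempty_iff_ne_empty]
    rintro rfl
    have : phi (lSet ∅ Z k) = fun _ => 1 := by
      funext x
      simp [phi, lSet]
    simp [this] at hτE
  set T : ℝ := ⨆ i : {i // i ∈ I},
    ((d I Z k (lVal Z k i) : ℝ) * (m i : ℝ)) ^ (1 / (lVal Z k i : ℝ)) with hT
  have hTle : ∀ i ∈ I, ((d I Z k (lVal Z k i) : ℝ) * (m i : ℝ)) ^ (1 / (lVal Z k i : ℝ)) ≤ T :=
    fun i hi => le_ciSup (f := fun i : {i // i ∈ I} =>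
      ((d I Z k (lVal Z k i) : ℝ) * (m i : ℝ)) ^ (1 / (lVal Z k i : ℝ)))
      (Set.finite_range _).bddAbove ⟨i, hi⟩
  have hTpos : 0 < T := by
    obtain ⟨i, hi⟩ := hI
    refine lt_of_lt_of_le (Real.rpow_pos_of_pos (mul_pos ?_ ?_) _) (hTle i hi)
    · exact Nat.cast_pos.2 (hd i hi)
    · exact Nat.cast_pos.2 (hm i hi)
  have hTpow : ∀ i ∈ I, (d I Z k (lVal Z k i) : ℝ) * (m i : ℝ) ≤ T ^ lVal Z k i := by
    intro i hi
    have h := pow_le_pow_left₀ (by positivity) (hTle i hi) (lVal Z k i)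
    rwa [one_div, Real.rpow_inv_natCast_pow (by positivity) (hl i hi).ne'] at h
  set γ : ℝ := deriv (phi (lSet I Z k)) τ with hγ
  have hNT : γ * T ≤ numColors I Z k m τ := Nat.le_ceil _
  have hφ : phi (lSet I Z k) τ = τ * γ := by linarith
  have hφpos : 0 < phi (lSet I Z k) τ := by
    unfold phi
    positivity
  have hγpos : 0 < γ := by
    rw [hφ] at hφpos
    exact pos_of_mul_pos_right hφpos hτ.le
  have hNpos : (0 : ℝ) < numColors I Z k m τ := (mul_pos hγpos hTpos).trans_le hNT
  set N := numColors I Z k m τ with hN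
  have hNρ : (N : ℝ) * (T / τ / N) = T / τ := by field_simp
  refine exists_avoids_of_weight_le hne hZ.surjOn hkm hL (Nat.cast_pos.1 hNpos)
    (ρ := T / τ / N) (by positivity) fun v => ?_
  rw [hNρ]
  -- Group the indices by `l`: each term is at most `τ ^ l / d_l` since `d_l * m_i ≤ T ^ l`, and at
  -- most `d_l` of them contain `v`.
  have hsum : ∑ i ∈ I with v ∈ Z i, (m i : ℝ) / (T / τ) ^ lVal Z k i ≤
      ∑ l ∈ lSet I Z k, τ ^ l := by
    rw [← Finset.sum_fiberwise_of_maps_to (t := lSet I Z k) (g := lVal Z k)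
      fun i hi => Finset.mem_image_of_mem _ (Finset.mem_filter.1 hi).1]
    refine Finset.sum_le_sum fun l hlE => ?_
    obtain ⟨j, hj, rfl⟩ := Finset.mem_image.1 hlE
    have hdj : (0 : ℝ) < d I Z k (lVal Z k j) := Nat.cast_pos.2 (hd j hj)
    rw [Finset.filter_filter]
    calc _ ≤ ∑ _i ∈ I with v ∈ Z _i ∧ lVal Z k _i = lVal Z k j,
          τ ^ lVal Z k j / d I Z k (lVal Z k j) := by
          refine Finset.sum_le_sum fun i hi => ?_
          rw [Finset.mem_filter] at hi
          have h := hTpow i hi.1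
          rw [hi.2.2] at h ⊢
          rw [div_pow, div_div_eq_mul_div, div_le_div_iff₀ (by positivity) hdj]
          nlinarith [pow_pos hτ (lVal Z k j)]
      _ ≤ d I Z k (lVal Z k j) * (τ ^ lVal Z k j / d I Z k (lVal Z k j)) := by
          rw [Finset.sum_const, nsmul_eq_mul]
          gcongr
          exact card_filter_le_d hZ.injOn k _ v
      _ = τ ^ lVal Z k j := by field_simp
  calc _ = T / τ / N * (1 + ∑ i ∈ I with v ∈ Z i, (m i : ℝ) / (T / τ) ^ lVal Z k i) := by
        rw [mul_add, mul_one, Finset.mul_sum]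
        congr 1
        exact Finset.sum_congr rfl fun i _ => by ring
    _ ≤ T / τ / N * phi (lSet I Z k) τ := by
        unfold phi
        gcongr
    _ = γ * T / N := by
        rw [hφ]
        field_simp
    _ ≤ 1 := (div_le_one hNpos).2 hNT

end Parameters

/-! ### The variable version of the Local Lemma -/

/-- Independent variables take any prescribed values of positive probability simultaneously with
positive probability. -/
theorem measure_iInter_preimage_singleton_pos {V K Ω : Type*} [Fintype V] [MeasurableSpace Ω]
    {P : Measure Ω} [MeasurableSpace K] [MeasurableSingletonClass K] {ψ : V → Ω → K}
    (hψ : iIndepFun ψ P) {f : V → K} (hf : ∀ v, P (ψ v ⁻¹' {f v}) ≠ 0) :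
    0 < P (⋂ v, ψ v ⁻¹' {f v}) := by
  have h := hψ.measure_inter_preimage_eq_mul Finset.univ (sets := fun v => {f v})
    fun v _ => measurableSet_singleton _
  simp only [Finset.mem_univ, Set.iInter_true] at h
  rw [h, pos_iff_ne_zero]
  exact Finset.prod_ne_zero_iff.2 fun v _ => hf v

end EntropyCompression

theorem theorem1 {V : Type*} [Fintype V] {K : Type*}
    (bad : Set (EntropyCompression.Setting V K))
    (hne : ∀ s ∈ bad, s.1.Nonempty)
    (I : Finset ℕ) (Z : ℕ → Finset V)
    (hZ : Set.BijOn Z (I : Set ℕ) (EntropyCompression.badSets bad))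
    (k m : ℕ → ℕ)
    (hkm : ∀ i ∈ I, EntropyCompression.ExtensionBound bad (Z i) (k i) (m i))
    (τ : ℝ) (hτ : 0 < τ)
    (hτE : EntropyCompression.phi (EntropyCompression.lSet I Z k) τ
      - τ * deriv (EntropyCompression.phi (EntropyCompression.lSet I Z k)) τ = 0) :
    -- a colouring from any palette of the given number of colours
    (∀ S : Finset K, S.card = EntropyCompression.numColors I Z k m τ →
      ∃ f : V → K, (∀ v, f v ∈ S) ∧ EntropyCompression.Avoids bad f) ∧
    -- the variable version of the Local Lemma: independent variables indexed by `V`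
    (∀ {Ω : Type*} [MeasurableSpace Ω] (P : Measure Ω) [IsProbabilityMeasure P]
        [MeasurableSpace K] [MeasurableSingletonClass K]
        (ψ : V → Ω → K) (_ : ∀ v, Measurable (ψ v)) (_ : iIndepFun ψ P)
        {X : Type*} [Finite X] (A : X → Set Ω) (vbl : X → Finset V)
        (c : ∀ x, Set ({v // v ∈ vbl x} → K))
        (_ : ∀ x, A x = {ω | (fun v : {v // v ∈ vbl x} => ψ v ω) ∈ c x})
        (_ : EntropyCompression.eventSettings vbl c = bad)
        (_ : ∀ v, (EntropyCompression.numColors I Z k m τ : ℕ∞)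
          ≤ {a : K | P (ψ v ⁻¹' {a}) ≠ 0}.encard),
      0 < P (⋂ x, (A x)ᶜ)) := by
  classical
  have key := EntropyCompression.exists_avoids_of_card_eq_numColors hne I Z hZ k m hkm τ hτ hτE
  refine ⟨fun S hS => key (fun _ => S) fun _ => hS, ?_⟩
  intro Ω _ P _ _ _ ψ _ hψ X _ A vbl c hA hbad hval
  -- The likely values may differ between variables, so lists replace the common palette.
  have hlist : ∀ v, ∃ S : Finset K, S.card = EntropyCompression.numColors I Z k m τ ∧
      ∀ a ∈ S, P (ψ v ⁻¹' {a}) ≠ 0 := by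
    intro v
    obtain ⟨t, ht, hcard⟩ := Set.exists_subset_encard_eq (hval v)
    have hfin : t.Finite := Set.finite_of_encard_eq_coe hcard
    refine ⟨hfin.toFinset, ?_, fun a ha => ht (hfin.mem_toFinset.1 ha)⟩
    rw [hfin.encard_eq_coe_toFinset_card] at hcard
    exact_mod_cast hcard
  choose L hL hLpos using hlist
  obtain ⟨f, hfL, hf⟩ := key L hL
  refine lt_of_lt_of_le (EntropyCompression.measure_iInter_preimage_singleton_pos hψ
    fun v => hLpos v _ (hfL v)) (measure_mono fun ω hω => ?_)
  have hω' : ∀ v, ψ v ω = f v := fun v => Set.mem_iInter.1 hω v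
  refine Set.mem_iInter.2 fun x hx => ?_
  rw [hA x, Set.mem_ofPred_eq] at hx
  simp only [hω'] at hx
  exact hf ⟨vbl x, fun v => f v⟩ (hbad ▸ ⟨x, _, hx, rfl⟩) rfl
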